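/- Let $P$ be a set of $n$ points in the plane, $n/2$ of them red and $n/2$ of them blue, that is semi-collinear: the blue points lie on a straight line $\ell$, and the red points are in general position (no three of them on a line) and do not lie on $\ell$. Let $M$ be a perfect bichromatic matching on $P$, that is, a perfect matching of $P$ by straight-line segments (edges), each of which joins a red point to a blue point. Two edges cross if they have a point in common; a matching is plane if no two of its edges cross. A flip replaces two crossing edges $rb$ and $r'b'$ ($r,r'$ red, $b,b'$ blue) by the two edges $rb'$ and $r'b$, which do not cross each other. Let $f(M)$ be the minimum number $k$ for which there are perfect bichromatic matchings $M=M_0,M_1,\dots,M_k$ on $P$ such that $M_{i+1}$ is obtained from $M_i$ by a single flip for each $i<k$ and $M_k$ is plane. Then such a sequence exists, and $$f(M)\leqslant \frac{n^2}{4}-\frac n2 .$$ -/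

import Mathlib

namespace BichromaticFlip

/-- The Euclidean plane. -/
abbrev Plane : Type := EuclideanSpace ℝ (Fin 2)

/-- No three distinct points of `S` lie on a common line. -/
def InGeneralPosition (S : Finset Plane) : Prop :=
  ∀ p ∈ S, ∀ q ∈ S, ∀ r ∈ S, p ≠ q → p ≠ r → q ≠ r → ¬ Collinear ℝ {p, q, r}

/-- Semi-collinear red points `R` and blue points `B`: the blue points lie on a line `ℓ`, the red
points are in general position, and each red point is off `ℓ` (on either side of it). -/
def SemiCollinear (R B : Finset Plane) : Prop :=
  InGeneralPosition R ∧
    ∃ ℓ : AffineSubspace ℝ Plane, Module.finrank ℝ ℓ.direction = 1 ∧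
      (∀ b ∈ B, b ∈ ℓ) ∧ (∀ r ∈ R, r ∉ ℓ)

/-- A perfect bichromatic matching on red points `R` and blue points `B`: each red point `r` is
joined by a straight-line edge to its blue partner `M r`, and each blue point has exactly one red
partner. -/
abbrev BichromaticMatching (R B : Finset Plane) : Type := {x // x ∈ R} ≃ {x // x ∈ B}

/-- The segments `ab` and `cd` cross, i.e. have a common point. This is applied only to segments
with four distinct endpoints. -/
def Cross (a b c d : Plane) : Prop := (segment ℝ a b ∩ segment ℝ c d).Nonempty

variable {R B : Finset Plane}

/-- A matching is plane if no two of its edges cross. -/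
def IsPlane (M : BichromaticMatching R B) : Prop :=
  ∀ r s : {x // x ∈ R}, r ≠ s → ¬ Cross r.1 (M r).1 s.1 (M s).1

/-- `M'` is obtained from `M` by a single flip: two crossing edges of `M` are replaced by the two
other edges between red and blue points among their endpoints; the new edges do not cross each
other, and all other edges are kept. -/
def IsFlip (M M' : BichromaticMatching R B) : Prop :=
  ∃ r s : {x // x ∈ R}, r ≠ s ∧
    Cross r.1 (M r).1 s.1 (M s).1 ∧ ¬ Cross r.1 (M s).1 s.1 (M r).1 ∧
    M' r = M s ∧ M' s = M r ∧ ∀ t, t ≠ r → t ≠ s → M' t = M t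

/-- There is a valid flip sequence `M = M₀, M₁, …, M_k` of length `k`: each `M_{i+1}` arises
from `M_i` by a single flip, and `M_k` is plane. -/
def HasFlipSequence (M : BichromaticMatching R B) (k : ℕ) : Prop :=
  ∃ S : ℕ → BichromaticMatching R B,
    S 0 = M ∧ (∀ i < k, IsFlip (S i) (S (i + 1))) ∧ IsPlane (S k)

/-- `f(M)`: the minimum length of a valid flip sequence for `M` (`⊤` if there is none). -/
noncomputable def minFlips (M : BichromaticMatching R B) : ℕ∞ :=
  ⨅ (k : ℕ) (_ : HasFlipSequence M k), (k : ℕ∞)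

end BichromaticFlip

/-! Take the blue line as the real axis. For a red point at abscissa `x` and height `y`, the value
of `v ↦ (x - v) / |y|` is the cotangent of the angle between the axis and the edge to the blue point
`v`. For blue `b < c`, the edges `rb` and `sc` meet exactly when `r` and `s` lie on the same side
and the function of `r` is at least that of `s` at both `b` and `c` (`exists_common_point_iff`).
From there on only affine functions matter: an inequality at both ends of an interval holds inside
it.

Blue points are inserted from left to right. After an insertion every crossing involves the edge of
one red point `q`, with blue endpoint `v`. This edge is flipped with the crossing edge whose red
point has the largest function at `v`, ties being broken just left of `v`. Then again only the edge
of `q` can be crossed (`AlmostPlane.swapEdges`), and its blue endpoint has moved strictly left. An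
insertion thus costs at most `|B| - 1` flips, and `|B| = n/2` insertions give the bound. -/

namespace BichromaticFlip

/-- Replacing two edges of a matching by the other two edges on the same endpoints. -/
noncomputable def swapEdges {R B : Finset Plane} (M : BichromaticMatching R B) (p q : {x // x ∈ R}) :
    BichromaticMatching R B :=
  (Equiv.swap p q).trans M

section Swap

variable {R B : Finset Plane} (M : BichromaticMatching R B) (p q : {x // x ∈ R})

theorem swapEdges_left : swapEdges M p q p = M q := by simp [swapEdges]

theorem swapEdges_right : swapEdges M p q q = M p := by simp [swapEdges]

theorem swapEdges_of_ne {r : {x // x ∈ R}} (hp : r ≠ p) (hq : r ≠ q) :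
    swapEdges M p q r = M r := by
  simp [swapEdges, Equiv.swap_apply_of_ne_of_ne hp hq]

end Swap

/-- `FlipPath M N k`: the matching `N` arises from `M` by `k` successive flips. -/
inductive FlipPath {R B : Finset Plane} :
    BichromaticMatching R B → BichromaticMatching R B → ℕ → Prop
  | refl (M : BichromaticMatching R B) : FlipPath M M 0
  | head {M M' N : BichromaticMatching R B} {k : ℕ} :
      IsFlip M M' → FlipPath M' N k → FlipPath M N (k + 1)

theorem FlipPath.trans {R B : Finset Plane} {M N L : BichromaticMatching R B} {j k : ℕ}
    (h : FlipPath M N j) (h' : FlipPath N L k) : FlipPath M L (j + k) := by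
  induction h with
  | refl => simpa using h'
  | head hf _ ih =>
    have := FlipPath.head hf (ih h')
    rwa [Nat.add_right_comm] at this

theorem FlipPath.hasFlipSequence {R B : Finset Plane} {M N : BichromaticMatching R B} {k : ℕ}
    (h : FlipPath M N k) (hN : IsPlane N) : HasFlipSequence M k := by
  induction h with
  | refl M => exact ⟨fun _ => M, rfl, by simp, hN⟩
  | @head M M' N k hf _ ih =>
    obtain ⟨S, h0, hS, hk⟩ := ih hN
    refine ⟨fun i => if i = 0 then M else S (i - 1), if_pos rfl, ?_, ?_⟩
    · rintro (_ | i) hi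
      · simpa [h0] using hf
      · simpa using hS i (by omega)
    · simpa using hk

/-! ### Dual model: crossings as inequalities between affine functions -/

/-- The dual picture of a semi-collinear point set: blue points are positions on the real line,
and each red point `r` is an affine function `v ↦ icpt r - v * slope r` together with the side of
the blue line on which `r` lies. -/
structure DualModel (R B : Finset Plane) where
  /-- position of a blue point -/
  pos : {x // x ∈ B} → ℝ
  /-- side of the blue line on which a red point lies -/
  side : {x // x ∈ R} → Prop
  /-- intercept of the affine function of a red point -/
  icpt : {x // x ∈ R} → ℝ
  /-- minus the slope of the affine function of a red point -/
  slope : {x // x ∈ R} → ℝ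
  pos_injective : Function.Injective pos
  red_ext : ∀ r s, side r = side s → icpt r = icpt s → slope r = slope s → r = s
  cross_iff : ∀ (r s : {x // x ∈ R}) (b c : {x // x ∈ B}), pos b < pos c →
    (Cross r.1 b.1 s.1 c.1 ↔ side r = side s ∧
      icpt s - pos b * slope s ≤ icpt r - pos b * slope r ∧
      icpt s - pos c * slope s ≤ icpt r - pos c * slope r)

theorem cross_comm (a b c d : Plane) : Cross a b c d ↔ Cross c d a b := by
  unfold Cross
  rw [Set.inter_comm]

namespace DualModel

variable {R B : Finset Plane} (D : DualModel R B)

/-- The affine function of a red point. -/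
def val (r : {x // x ∈ R}) (v : ℝ) : ℝ := D.icpt r - v * D.slope r

/-- The red points `r` and `s` are on the same side, and the function of `r` is at least the
function of `s` at both `u` and `v`. -/
def Over (r s : {x // x ∈ R}) (u v : ℝ) : Prop :=
  D.side r = D.side s ∧ D.val s u ≤ D.val r u ∧ D.val s v ≤ D.val r v

variable {D}

theorem cross_iff_over {r s : {x // x ∈ R}} {b c : {x // x ∈ B}} (h : D.pos b < D.pos c) :
    Cross r.1 b.1 s.1 c.1 ↔ D.Over r s (D.pos b) (D.pos c) :=
  D.cross_iff r s b c h

theorem val_comb (r : {x // x ∈ R}) (u v w : ℝ) :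
    (w - u) * D.val r v = (w - v) * D.val r u + (v - u) * D.val r w := by
  unfold val
  ring

theorem val_mid_le {r s : {x // x ∈ R}} {u v w : ℝ} (huv : u ≤ v) (hvw : v ≤ w)
    (hu : D.val s u ≤ D.val r u) (hw : D.val s w ≤ D.val r w) : D.val s v ≤ D.val r v := by
  rcases huv.eq_or_lt with rfl | huv
  · exact hu
  have h1 := D.val_comb r u v w
  have h2 := D.val_comb s u v w
  have h3 := mul_le_mul_of_nonneg_left hu (sub_nonneg.2 hvw)
  have h4 := mul_le_mul_of_nonneg_left hw (sub_pos.2 huv).le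
  exact le_of_mul_le_mul_left (by linarith) (sub_pos.2 (huv.trans_le hvw))

theorem val_mid_lt {r s : {x // x ∈ R}} {u v w : ℝ} (huv : u ≤ v) (hvw : v < w)
    (hu : D.val s u < D.val r u) (hw : D.val s w ≤ D.val r w) : D.val s v < D.val r v := by
  have h1 := D.val_comb r u v w
  have h2 := D.val_comb s u v w
  have h3 := mul_lt_mul_of_pos_left hu (sub_pos.2 hvw)
  have h4 := mul_le_mul_of_nonneg_left hw (sub_nonneg.2 huv)
  exact lt_of_mul_lt_mul_left (by linarith) (sub_pos.2 (huv.trans_lt hvw)).le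

theorem eq_of_val_eq {r s : {x // x ∈ R}} {u v : ℝ} (hside : D.side r = D.side s) (huv : u < v)
    (hu : D.val r u = D.val s u) (hv : D.val r v = D.val s v) : r = s := by
  unfold val at hu hv
  have h : (v - u) * (D.slope r - D.slope s) = 0 := by linarith
  have hs : D.slope r = D.slope s :=
    sub_eq_zero.1 ((mul_eq_zero.1 h).resolve_left (sub_pos.2 huv).ne')
  exact D.red_ext r s hside (by rw [hs] at hu; linarith) hs

/-- This makes a flip legitimate: if the new edges crossed as well, the two affine functions would
agree at two points. -/
theorem eq_of_over_over {r s : {x // x ∈ R}} {u v : ℝ} (huv : u < v)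
    (h : D.Over r s u v) (h' : D.Over s r u v) : r = s :=
  eq_of_val_eq h.1 huv (le_antisymm h'.2.1 h.2.1) (le_antisymm h'.2.2 h.2.2)

/-- Two crossing edges can be flipped. -/
theorem isFlip_swapEdges {M : BichromaticMatching R B} {p q : {x // x ∈ R}}
    (h : D.pos (M p) < D.pos (M q)) (hover : D.Over p q (D.pos (M p)) (D.pos (M q))) :
    IsFlip M (swapEdges M p q) := by
  have hne : p ≠ q := by
    rintro rfl
    exact h.ne rfl
  refine ⟨p, q, hne, (cross_iff_over h).2 hover, ?_, swapEdges_left M p q,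
    swapEdges_right M p q, fun t hp hq => swapEdges_of_ne M p q hp hq⟩
  rw [cross_comm, cross_iff_over h]
  exact fun h' => hne (eq_of_over_over h hover h')

/-- Among the functions in `C`, one is extreme at `v` and immediately to the left of `v`. -/
theorem exists_extreme (C : Finset {x // x ∈ R}) (hC : C.Nonempty) (v : ℝ) :
    ∃ p ∈ C, ∀ y ∈ C, D.val y v ≤ D.val p v ∧ (y ≠ p → ∀ u < v, ¬ D.Over y p u v) := by
  -- The lexicographic order breaks ties at `v`: of two functions equal there, the one with larger
  -- `slope` is larger to the left of `v`.
  obtain ⟨p, hp, hmax⟩ := C.exists_max_image (fun p => toLex (D.val p v, D.slope p)) hC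
  refine ⟨p, hp, fun y hy => ?_⟩
  have h := Prod.Lex.toLex_le_toLex.1 (hmax y hy)
  dsimp only at h
  refine ⟨?_, fun hne u hu hover => ?_⟩
  · rcases h with h | h
    exacts [h.le, h.1.le]
  · rcases h with h | ⟨h, hs⟩
    · exact absurd hover.2.2 h.not_ge
    · refine hne (eq_of_val_eq hover.1 hu (le_antisymm ?_ hover.2.1) h)
      have := mul_le_mul_of_nonneg_left hs (sub_pos.2 hu).le
      unfold val at h ⊢
      linarith

/-! ### The flip invariant -/

variable (D)

/-- The edges with blue endpoint in `T` do not cross each other, except that the edge of `q` may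
cross edges with blue endpoint before that of `q`; and moving a red point whose edge crosses that of
`q` to the blue endpoint of `q` creates no crossing with edges after it. -/
structure AlmostPlane (T : Finset {x // x ∈ B}) (M : BichromaticMatching R B)
    (q : {x // x ∈ R}) : Prop where
  mem : M q ∈ T
  rest : ∀ r s, r ≠ q → s ≠ q → M r ∈ T → M s ∈ T → D.pos (M r) < D.pos (M s) →
    ¬ D.Over r s (D.pos (M r)) (D.pos (M s))
  after : ∀ s, M s ∈ T → D.pos (M q) < D.pos (M s) → ¬ D.Over q s (D.pos (M q)) (D.pos (M s))
  move : ∀ p s, M p ∈ T → M s ∈ T → D.pos (M p) < D.pos (M q) → D.pos (M q) < D.pos (M s) →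
    D.Over p q (D.pos (M p)) (D.pos (M q)) → ¬ D.Over p s (D.pos (M q)) (D.pos (M s))

variable {D}

/-- The extremality `hext` keeps `p`, now matched to the old endpoint of `q`, from being crossed by
edges further left. Each possible new crossing is carried by interpolation to one excluded by the
old invariant or by `hext`. -/
theorem AlmostPlane.swapEdges {T : Finset {x // x ∈ B}} {M : BichromaticMatching R B}
    {p q : {x // x ∈ R}} (h : D.AlmostPlane T M q) (hpT : M p ∈ T)
    (hpq : D.pos (M p) < D.pos (M q)) (hover : D.Over p q (D.pos (M p)) (D.pos (M q)))
    (hext : ∀ y, M y ∈ T → D.pos (M y) < D.pos (M q) →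
      D.Over y q (D.pos (M y)) (D.pos (M q)) →
      D.val y (D.pos (M q)) ≤ D.val p (D.pos (M q)) ∧
        (y ≠ p → ∀ u < D.pos (M q), ¬ D.Over y p u (D.pos (M q)))) :
    D.AlmostPlane T (swapEdges M p q) q := by
  have hne : p ≠ q := by
    rintro rfl
    exact hpq.ne rfl
  have hq : BichromaticFlip.swapEdges M p q q = M p := swapEdges_right M p q
  have hp : BichromaticFlip.swapEdges M p q p = M q := swapEdges_left M p q
  have ho : ∀ r, r ≠ p → r ≠ q → BichromaticFlip.swapEdges M p q r = M r :=
    fun r => swapEdges_of_ne M p q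
  have hposne : ∀ r s, r ≠ s → D.pos (M r) ≠ D.pos (M s) := fun r s hrs he =>
    hrs (M.injective (D.pos_injective he))
  obtain ⟨hside, hov1, hov2⟩ := hover
  refine ⟨by rwa [hq], ?_, ?_, ?_⟩
  · intro r s hr hs hrT hsT hrs hc
    by_cases hrp : r = p
    · subst hrp
      have hsr : s ≠ r := by
        rintro rfl
        exact hrs.ne rfl
      rw [hp] at hrT hrs hc
      rw [ho s hsr hs] at hsT hrs hc
      exact h.move r s hpT hsT hpq hrs ⟨hside, hov1, hov2⟩ hc
    · rw [ho r hrp hr] at hrT hrs hc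
      by_cases hsp : s = p
      · subst hsp
        rw [hp] at hsT hrs hc
        rcases lt_or_gt_of_ne (hposne r s hrp) with hlt | hlt
        · exact h.rest r s hr hs hrT hpT hlt
            ⟨hc.1, hc.2.1, val_mid_le hlt.le hpq.le hc.2.1 hc.2.2⟩
        · have hqr : D.Over r q (D.pos (M r)) (D.pos (M q)) :=
            ⟨hc.1.trans hside, (val_mid_le hlt.le hrs.le hov1 hov2).trans hc.2.1,
              hov2.trans hc.2.2⟩
          exact (hext r hrT hrs hqr).2 hrp _ hrs hc
      · rw [ho s hsp hs] at hsT hrs hc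
        exact h.rest r s hr hs hrT hsT hrs hc
  · intro s hsT hqs hc
    rw [hq] at hqs hc
    have hsq : s ≠ q := by
      rintro rfl
      rw [hq] at hqs
      exact hqs.ne rfl
    by_cases hsp : s = p
    · subst hsp
      rw [hp] at hc
      exact hne (eq_of_over_over hpq ⟨hside, hov1, hov2⟩ hc)
    · rw [ho s hsp hsq] at hsT hqs hc
      rcases lt_or_gt_of_ne (hposne s q hsq) with hlt | hlt
      · exact h.rest p s hne hsq hpT hsT hqs
          ⟨hside.trans hc.1, hc.2.1.trans hov1,
            hc.2.2.trans (val_mid_le hqs.le hlt.le hov1 hov2)⟩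
      · exact h.after s hsT hlt ⟨hc.1, val_mid_le hpq.le hlt.le hc.2.1 hc.2.2, hc.2.2⟩
  · intro p' s hp'T hsT hp'q hqs hc hd
    rw [hq] at hp'q hqs hc hd
    have hp'ne : p' ≠ q := by
      rintro rfl
      rw [hq] at hp'q
      exact hp'q.ne rfl
    have hp'p : p' ≠ p := by
      rintro rfl
      rw [hp] at hp'q
      exact absurd hp'q hpq.not_gt
    have hsq : s ≠ q := by
      rintro rfl
      rw [hq] at hqs
      exact hqs.ne rfl
    rw [ho p' hp'p hp'ne] at hp'T hp'q hc
    have hp'v : D.pos (M p') < D.pos (M q) := hp'q.trans hpq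
    have hover' : D.val q (D.pos (M q)) ≤ D.val p' (D.pos (M q)) →
        D.Over p' q (D.pos (M p')) (D.pos (M q)) := fun h => ⟨hc.1, hc.2.1, h⟩
    by_cases hsp : s = p
    · subst hsp
      rw [hp] at hd
      exact (hext p' hp'T hp'v (hover' (hov2.trans hd.2.2))).2 hp'p _ hpq hd
    · rw [ho s hsp hsq] at hsT hqs hd
      rcases lt_or_gt_of_ne (hposne s q hsq) with hlt | hlt
      -- The blue endpoint of `s` lies between those of `p` and `q`. If `p'` were at least `p` at
      -- the endpoint of `p`, then `hle` would force it to be so at its own endpoint too, and the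
      -- old edges of `p'` and `p` would cross. Otherwise `p` dominates `p'`, hence `s`, and the old
      -- edges of `p` and `s` cross.
      · have hle : D.val p' (D.pos (M q)) ≤ D.val p (D.pos (M q)) := by
          rcases le_or_gt (D.val q (D.pos (M q))) (D.val p' (D.pos (M q))) with hle | hle
          · exact (hext p' hp'T hp'v (hover' hle)).1
          · exact hle.le.trans hov2
        have hsame : D.side p' = D.side p := hc.1.trans hside.symm
        rcases le_or_gt (D.val p (D.pos (M p))) (D.val p' (D.pos (M p))) with hcmp | hcmp
        · have hlt' : D.val p' (D.pos (M p')) < D.val p (D.pos (M p')) := by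
            by_contra hcon
            exact h.rest p' p hp'ne hne hp'T hpT hp'q ⟨hsame, not_lt.1 hcon, hcmp⟩
          exact (val_mid_lt hp'q.le hpq hlt' hle).not_ge hcmp
        · refine h.rest p s hne hsq hpT hsT hqs
            ⟨hsame.symm.trans hd.1, hd.2.1.trans hcmp.le, hd.2.2.trans ?_⟩
          exact (val_mid_lt hqs.le hlt hcmp hle).le
      · rcases le_or_gt (D.val q (D.pos (M q))) (D.val p' (D.pos (M q))) with hle | hle
        · exact h.move p' s hp'T hsT hp'v hlt (hover' hle)
            ⟨hd.1, val_mid_le hpq.le hlt.le hd.2.1 hd.2.2, hd.2.2⟩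
        -- Now `p'` is at least `q` at the endpoint of `p` but below it at that of `q`, so it stays
        -- below further right, and `q` inherits from `p'` the domination of `s`.
        · have hs1 := val_mid_le hpq.le hlt.le hd.2.1 hd.2.2
          refine h.after s hsT hlt ⟨hc.1.symm.trans hd.1, hs1.trans hle.le, ?_⟩
          refine hd.2.2.trans (le_of_not_gt fun hgt => ?_)
          exact hle.not_ge (val_mid_le hpq.le hlt.le hc.2.2 hgt.le)

variable (D)

/-- The edges with blue endpoint in `T` do not cross each other. -/
def PlaneOn (T : Finset {x // x ∈ B}) (M : BichromaticMatching R B) : Prop :=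
  ∀ r s, M r ∈ T → M s ∈ T → D.pos (M r) < D.pos (M s) →
    ¬ D.Over r s (D.pos (M r)) (D.pos (M s))

variable {D}

/-- The blue points of `T` left of the endpoint of `q` serve as the potential: a flip moves that
endpoint to one of them. When no edge from the left crosses that of `q`, the invariant leaves no
crossing at all. -/
theorem AlmostPlane.exists_flipPath {T : Finset {x // x ∈ B}} {q : {x // x ∈ R}} (m : ℕ) :
    ∀ M : BichromaticMatching R B, D.AlmostPlane T M q →
      (T.filter fun b => D.pos b < D.pos (M q)).card ≤ m →
      ∃ N, ∃ k ≤ m, FlipPath M N k ∧ D.PlaneOn T N := by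
  classical
  induction m with
  | zero =>
    intro M h hm
    refine ⟨M, 0, le_rfl, .refl M, fun r s hr hs hrs => ?_⟩
    have hempty := Finset.filter_eq_empty_iff.1 (Finset.card_eq_zero.1 (Nat.le_zero.1 hm))
    by_cases hrq : r = q
    · subst hrq
      exact h.after s hs hrs
    · by_cases hsq : s = q
      · subst hsq
        exact absurd hrs (hempty hr)
      · exact h.rest r s hrq hsq hr hs hrs
  | succ m ih =>
    intro M h hm
    set C : Finset {x // x ∈ R} := Finset.univ.filter fun y =>
      M y ∈ T ∧ D.pos (M y) < D.pos (M q) ∧ D.Over y q (D.pos (M y)) (D.pos (M q)) with hCdef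
    rcases C.eq_empty_or_nonempty with hC | hC
    · refine ⟨M, 0, Nat.zero_le _, .refl M, fun r s hr hs hrs hc => ?_⟩
      by_cases hrq : r = q
      · subst hrq
        exact h.after s hs hrs hc
      · by_cases hsq : s = q
        · subst hsq
          have : r ∈ C := by simp [hCdef, hr, hrs, hc]
          simp [hC] at this
        · exact h.rest r s hrq hsq hr hs hrs hc
    · obtain ⟨p, hpC, hmax⟩ := D.exists_extreme C hC (D.pos (M q))
      obtain ⟨hpT, hpq, hover⟩ := (Finset.mem_filter.1 hpC).2
      have h' := h.swapEdges hpT hpq hover fun y h1 h2 h3 =>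
        hmax y (Finset.mem_filter.2 ⟨Finset.mem_univ _, h1, h2, h3⟩)
      obtain ⟨N, k, hk, hpath, hN⟩ := ih _ h' (by
        rw [swapEdges_right]
        refine Nat.le_of_lt_succ (lt_of_lt_of_le (Finset.card_lt_card ?_) hm)
        refine Finset.ssubset_iff_of_subset ?_ |>.2 ⟨M p, by simp [hpT, hpq], by simp⟩
        intro b hb
        simp only [Finset.mem_filter] at hb ⊢
        exact ⟨hb.1, hb.2.trans hpq⟩)
      exact ⟨N, k + 1, by omega, .head (isFlip_swapEdges hpq hover) hpath, hN⟩

-- Blue points are added in increasing position. The new one is rightmost, so the invariant's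
-- conditions on edges to its right are vacuous.
variable (D) in
theorem exists_planeOn (M : BichromaticMatching R B) (T : Finset {x // x ∈ B}) :
    ∃ N, ∃ k ≤ T.card * (B.card - 1), FlipPath M N k ∧ D.PlaneOn T N := by
  classical
  induction T using Finset.induction_on_max_value D.pos with
  | empty => exact ⟨M, 0, by simp, .refl M, by simp [PlaneOn]⟩
  | insert a S ha hmax ih =>
    obtain ⟨N, k, hk, hpath, hN⟩ := ih
    have hq : N (N.symm a) = a := N.apply_symm_apply a
    have hS : ∀ r, N r ∈ insert a S → r ≠ N.symm a → N r ∈ S := fun r hr hne =>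
      (Finset.mem_insert.1 hr).resolve_left fun he => hne (by rw [← he, N.symm_apply_apply])
    have hnot : ∀ s, N s ∈ insert a S → ¬ D.pos (N (N.symm a)) < D.pos (N s) := by
      intro s hs
      rw [hq, not_lt]
      rcases Finset.mem_insert.1 hs with he | he
      · rw [he]
      · exact hmax _ he
    have halmost : D.AlmostPlane (insert a S) N (N.symm a) :=
      ⟨by simp, fun r s hr hs hrT hsT => hN r s (hS r hrT hr) (hS s hsT hs),
        fun s hs hlt => absurd hlt (hnot s hs), fun p s _ hs _ hlt => absurd hlt (hnot s hs)⟩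
    have hcard : (insert a S).card ≤ B.card := by
      simpa using Finset.card_le_univ (insert a S)
    rw [Finset.card_insert_of_notMem ha] at hcard
    obtain ⟨N', k', hk', hpath', hN'⟩ := halmost.exists_flipPath (B.card - 1) N (by
      -- The new point `a` is not left of itself, so only `S` counts, and `S` omits `a`: hence `|B|
      -- - 1`.
      refine le_trans (Finset.card_le_card (t := S) ?_) (by omega)
      intro b hb
      obtain ⟨hb, hlt⟩ := Finset.mem_filter.1 hb
      refine (Finset.mem_insert.1 hb).resolve_left ?_
      rintro rfl
      exact hlt.ne (by rw [hq]))
    refine ⟨N', k + k', ?_, hpath.trans hpath', hN'⟩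
    rw [Finset.card_insert_of_notMem ha, Nat.succ_mul]
    exact Nat.add_le_add hk hk'

theorem exists_hasFlipSequence (D : DualModel R B) (M : BichromaticMatching R B) :
    ∃ k ≤ B.card * (B.card - 1), HasFlipSequence M k := by
  obtain ⟨N, k, hk, hpath, hN⟩ := D.exists_planeOn M Finset.univ
  refine ⟨k, by simpa using hk, hpath.hasFlipSequence fun r s hrs hc => ?_⟩
  rcases lt_trichotomy (D.pos (N r)) (D.pos (N s)) with h | h | h
  · exact hN r s (Finset.mem_univ _) (Finset.mem_univ _) h ((cross_iff_over h).1 hc)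
  · exact hrs (N.injective (D.pos_injective h))
  · rw [cross_comm] at hc
    exact hN s r (Finset.mem_univ _) (Finset.mem_univ _) h ((cross_iff_over h).1 hc)

end DualModel
end BichromaticFlip

/-! ### Coordinates: realizing the dual model in the plane -/

namespace BichromaticFlip

theorem abs_eq_mul_sign_iff {y z : ℝ} (hy : y ≠ 0) (hz : z ≠ 0) (h : (0 < y) = (0 < z)) :
    ∃ σ : ℝ, y = σ * |y| ∧ z = σ * |z| := by
  rcases hy.lt_or_gt with hy' | hy'
  · have hz' : z < 0 := hz.lt_of_le (not_lt.1 fun h' => hy'.not_gt (h.symm ▸ h'))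
    exact ⟨-1, by rw [abs_of_neg hy']; ring, by rw [abs_of_neg hz']; ring⟩
  · have hz' : 0 < z := h ▸ hy'
    exact ⟨1, by rw [abs_of_pos hy', one_mul], by rw [abs_of_pos hz', one_mul]⟩

/-- Segments from `(b, 0)` to `(x, y)` and from `(c, 0)` to `(x', y')` in coordinates. -/
theorem exists_common_point_iff {b c x y x' y' : ℝ} (hbc : b < c) (hy : y ≠ 0) (hy' : y' ≠ 0) :
    (∃ l m : ℝ, (0 ≤ l ∧ l ≤ 1) ∧ (0 ≤ m ∧ m ≤ 1) ∧ l * y = m * y' ∧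
      b + l * (x - b) = c + m * (x' - c)) ↔
    (0 < y) = (0 < y') ∧ x' / |y'| - b * (1 / |y'|) ≤ x / |y| - b * (1 / |y|) ∧
      x' / |y'| - c * (1 / |y'|) ≤ x / |y| - c * (1 / |y|) := by
  have ha : 0 < |y| := abs_pos.2 hy
  have he : 0 < |y'| := abs_pos.2 hy'
  constructor
  · rintro ⟨l, m, ⟨hl0, hl1⟩, ⟨hm0, hm1⟩, h1, h2⟩
    have hl : 0 < l := by
      refine hl0.lt_of_ne' ?_
      rintro rfl
      rw [zero_mul, eq_comm, mul_eq_zero, or_iff_left hy'] at h1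
      rw [h1] at h2
      linarith
    have hm : 0 < m := by
      refine hm0.lt_of_ne' ?_
      rintro rfl
      rw [zero_mul, mul_eq_zero, or_iff_left hy] at h1
      exact hl.ne' h1
    refine ⟨?_, ?_⟩
    · rw [← mul_pos_iff_of_pos_left hl, h1, mul_pos_iff_of_pos_left hm]
    have h3 : l * |y| = m * |y'| := by
      have := congrArg abs h1
      rwa [abs_mul, abs_mul, abs_of_pos hl, abs_of_pos hm] at this
    have hk : 0 < l * |y| := mul_pos hl ha
    have e1 : ∀ v, l * |y| * (x / |y| - v * (1 / |y|)) = l * (x - v) := by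
      intro v
      field_simp
    have e2 : ∀ v, l * |y| * (x' / |y'| - v * (1 / |y'|)) = m * (x' - v) := by
      intro v
      rw [h3]
      field_simp
    -- After scaling by the common height `l * |y|`, the two differences are `(c - b) * (1 - m)` and
    -- `(c - b) * (1 - l)`.
    constructor
    · refine le_of_mul_le_mul_left ?_ hk
      rw [e1, e2]
      nlinarith
    · refine le_of_mul_le_mul_left ?_ hk
      rw [e1, e2]
      nlinarith
  · rintro ⟨hs, h1, h2⟩
    obtain ⟨σ, hσ, hσ'⟩ := abs_eq_mul_sign_iff hy hy' hs
    set a := |y|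
    set e := |y'|
    have f1 : (c - b) * (1 / e) ≤ (x - b) / a - (x' - c) / e := by
      have : (x - b) / a - (x' - c) / e = x / a - b * (1 / a) - (x' / e - b * (1 / e))
        + (c - b) * (1 / e) := by ring
      linarith
    have f2 : (c - b) * (1 / a) ≤ (x - b) / a - (x' - c) / e := by
      have : (x - b) / a - (x' - c) / e = x / a - c * (1 / a) - (x' / e - c * (1 / e))
        + (c - b) * (1 / a) := by ring
      linarith
    have hcb : 0 < c - b := sub_pos.2 hbc
    set w := (x - b) / a - (x' - c) / e with hw
    have hwpos : 0 < w := lt_of_lt_of_le (by positivity) f1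
    -- At height `h` the abscissas agree when `h * w = c - b`, so `h = (c - b) / w`, `l = h / a` and
    -- `m = h / e`. The bounds `l ≤ 1` and `m ≤ 1` are `f2` and `f1`, the inequalities at `c` and
    -- `b`.
    refine ⟨(c - b) / w / a, (c - b) / w / e, ⟨by positivity, ?_⟩, ⟨by positivity, ?_⟩, ?_, ?_⟩
    · rw [div_div, div_le_one (by positivity)]
      rw [mul_one_div, div_le_iff₀ ha] at f2
      exact f2
    · rw [div_div, div_le_one (by positivity)]
      rw [mul_one_div, div_le_iff₀ he] at f1
      exact f1
    · rw [hσ, hσ']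
      field_simp
    · have : (c - b) / w / a * (x - b) - (c - b) / w / e * (x' - c) = (c - b) / w * w := by
        rw [hw]
        ring
      rw [div_mul_cancel₀ _ hwpos.ne'] at this
      linarith

/-- The coordinate along the direction `d`, up to scaling. -/
def coordAlong (o d p : Plane) : ℝ := d 0 * (p 0 - o 0) + d 1 * (p 1 - o 1)

/-- The coordinate perpendicular to the direction `d`, up to scaling. -/
def coordAcross (o d p : Plane) : ℝ := d 0 * (p 1 - o 1) - d 1 * (p 0 - o 0)

theorem normSq_pos_of_ne_zero {d : Plane} (hd : d ≠ 0) : 0 < d 0 * d 0 + d 1 * d 1 := by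
  by_contra h
  refine hd ?_
  ext i
  fin_cases i
  · change d 0 = 0
    nlinarith [mul_self_nonneg (d 0), mul_self_nonneg (d 1)]
  · change d 1 = 0
    nlinarith [mul_self_nonneg (d 0), mul_self_nonneg (d 1)]

theorem eq_of_coord_eq {o d p q : Plane} (hd : d ≠ 0)
    (h1 : coordAlong o d p = coordAlong o d q) (h2 : coordAcross o d p = coordAcross o d q) :
    p = q := by
  have hn := normSq_pos_of_ne_zero hd
  unfold coordAlong at h1
  unfold coordAcross at h2
  have e0 : (d 0 * d 0 + d 1 * d 1) * (p 0 - q 0) = 0 := by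
    linear_combination d 0 * h1 - d 1 * h2
  have e1 : (d 0 * d 0 + d 1 * d 1) * (p 1 - q 1) = 0 := by
    linear_combination d 1 * h1 + d 0 * h2
  ext i
  fin_cases i
  · exact sub_eq_zero.1 ((mul_eq_zero.1 e0).resolve_left hn.ne')
  · exact sub_eq_zero.1 ((mul_eq_zero.1 e1).resolve_left hn.ne')

theorem coordAlong_comb (o d p q : Plane) {s t : ℝ} (h : s + t = 1) :
    coordAlong o d (s • p + t • q) = s * coordAlong o d p + t * coordAlong o d q := by
  simp only [coordAlong, PiLp.add_apply, PiLp.smul_apply, smul_eq_mul]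
  linear_combination (d 0 * o 0 + d 1 * o 1) * h

theorem coordAcross_comb (o d p q : Plane) {s t : ℝ} (h : s + t = 1) :
    coordAcross o d (s • p + t • q) = s * coordAcross o d p + t * coordAcross o d q := by
  simp only [coordAcross, PiLp.add_apply, PiLp.smul_apply, smul_eq_mul]
  linear_combination (d 0 * o 1 - d 1 * o 0) * h

theorem cross_iff_coord {o d r b s c : Plane} (hd : d ≠ 0) (hb : coordAcross o d b = 0)
    (hc : coordAcross o d c = 0) :
    Cross r b s c ↔ ∃ l m : ℝ, (0 ≤ l ∧ l ≤ 1) ∧ (0 ≤ m ∧ m ≤ 1) ∧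
      l * coordAcross o d r = m * coordAcross o d s ∧
      coordAlong o d b + l * (coordAlong o d r - coordAlong o d b) =
        coordAlong o d c + m * (coordAlong o d s - coordAlong o d c) := by
  constructor
  · rintro ⟨_, ⟨l, l', hl, hl', hll, rfl⟩, ⟨m, m', hm, hm', hmm, he⟩⟩
    have h1 := congrArg (coordAlong o d) he
    have h2 := congrArg (coordAcross o d) he
    rw [coordAlong_comb o d _ _ hll, coordAlong_comb o d _ _ hmm] at h1
    rw [coordAcross_comb o d _ _ hll, coordAcross_comb o d _ _ hmm, hb, hc] at h2
    refine ⟨l, m, ⟨hl, by linarith⟩, ⟨hm, by linarith⟩, by linarith, ?_⟩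
    obtain rfl : l' = 1 - l := by linarith
    obtain rfl : m' = 1 - m := by linarith
    linarith
  · rintro ⟨l, m, ⟨hl0, hl1⟩, ⟨hm0, hm1⟩, h1, h2⟩
    refine ⟨l • r + (1 - l) • b, ⟨l, 1 - l, hl0, by linarith, by ring, rfl⟩,
      ⟨m, 1 - m, hm0, by linarith, by ring, ?_⟩⟩
    refine eq_of_coord_eq (o := o) hd ?_ ?_
    · rw [coordAlong_comb o d _ _ (by ring), coordAlong_comb o d _ _ (by ring)]
      linarith
    · rw [coordAcross_comb o d _ _ (by ring), coordAcross_comb o d _ _ (by ring), hb, hc]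
      linarith

theorem exists_coordAcross_eq_zero_iff {ℓ : AffineSubspace ℝ Plane}
    (h : Module.finrank ℝ ℓ.direction = 1) :
    ∃ o d : Plane, d ≠ 0 ∧ ∀ p, p ∈ ℓ ↔ coordAcross o d p = 0 := by
  have hne : (ℓ : Set Plane).Nonempty := by
    rw [AffineSubspace.nonempty_iff_ne_bot]
    rintro rfl
    rw [AffineSubspace.direction_bot, finrank_bot] at h
    exact zero_ne_one h
  obtain ⟨o, ho⟩ := hne
  obtain ⟨⟨d, hdmem⟩, hd, hspan⟩ := finrank_eq_one_iff'.1 h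
  have hd0 : d ≠ 0 := fun h0 => hd (Subtype.ext h0)
  refine ⟨o, d, hd0, fun p => ?_⟩
  rw [← AffineSubspace.vsub_right_mem_direction_iff_mem ho]
  have hn := normSq_pos_of_ne_zero hd0
  constructor
  · intro hp
    obtain ⟨c, hc⟩ := hspan ⟨_, hp⟩
    have hc' : c • d = p - o := congrArg Subtype.val hc
    have h0 := congrArg (fun v : Plane => v 0) hc'
    have h1 := congrArg (fun v : Plane => v 1) hc'
    simp only [PiLp.smul_apply, PiLp.sub_apply, smul_eq_mul] at h0 h1
    rw [coordAcross, ← h0, ← h1]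
    ring
  · intro hp
    -- The right side is the orthogonal projection of `p - o` to `d`; nothing is lost because the
    -- perpendicular coordinate vanishes.
    have he : p -ᵥ o = (coordAlong o d p / (d 0 * d 0 + d 1 * d 1)) • d := by
      unfold coordAcross at hp
      unfold coordAlong
      ext i
      fin_cases i
      · simp only [vsub_eq_sub, PiLp.smul_apply, PiLp.sub_apply, smul_eq_mul, Fin.zero_eta]
        rw [div_mul_eq_mul_div, eq_div_iff hn.ne']
        linear_combination -d 1 * hp
      · simp only [vsub_eq_sub, PiLp.smul_apply, PiLp.sub_apply, smul_eq_mul, Fin.mk_one]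
        rw [div_mul_eq_mul_div, eq_div_iff hn.ne']
        linear_combination d 0 * hp
    rw [he]
    exact ℓ.direction.smul_mem _ hdmem

theorem SemiCollinear.nonempty_dualModel {R B : Finset Plane} (h : SemiCollinear R B) :
    Nonempty (DualModel R B) := by
  obtain ⟨-, ℓ, hℓ, hB, hR⟩ := h
  obtain ⟨o, d, hd, hmem⟩ := exists_coordAcross_eq_zero_iff hℓ
  have hb : ∀ b : {x // x ∈ B}, coordAcross o d b.1 = 0 := fun b => (hmem _).1 (hB _ b.2)
  have hr : ∀ r : {x // x ∈ R}, coordAcross o d r.1 ≠ 0 := fun r h0 => hR _ r.2 ((hmem _).2 h0)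
  refine ⟨{
    pos := fun b => coordAlong o d b.1
    side := fun r => 0 < coordAcross o d r.1
    icpt := fun r => coordAlong o d r.1 / |coordAcross o d r.1|
    slope := fun r => 1 / |coordAcross o d r.1|
    pos_injective := fun b c hbc => Subtype.ext (eq_of_coord_eq hd hbc ((hb b).trans (hb c).symm))
    red_ext := fun r s hside hicpt hslope => ?_
    cross_iff := fun r s b c hbc => ?_ }⟩
  · have habs : |coordAcross o d r.1| = |coordAcross o d s.1| := by
      simpa using hslope
    obtain ⟨σ, h1, h2⟩ := abs_eq_mul_sign_iff (hr r) (hr s) hside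
    rw [habs, div_left_inj' (abs_pos.2 (hr s)).ne'] at hicpt
    exact Subtype.ext (eq_of_coord_eq hd hicpt (by rw [h1, h2, habs]))
  · rw [cross_iff_coord hd (hb b) (hb c)]
    exact exists_common_point_iff hbc (hr r) (hr s)

theorem exists_minFlips_eq {R B : Finset Plane} {M : BichromaticMatching R B} {k : ℕ}
    (h : HasFlipSequence M k) : ∃ j ≤ k, minFlips M = (j : ℕ∞) := by
  have hle : minFlips M ≤ (k : ℕ∞) := iInf₂_le k h
  obtain ⟨j, hj⟩ := ENat.ne_top_iff_exists.1 (ne_top_of_le_ne_top (ENat.natCast_ne_top k) hle)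
  rw [← hj] at hle
  exact ⟨j, by exact_mod_cast hle, hj.symm⟩

end BichromaticFlip

theorem theorem7 (R B : Finset BichromaticFlip.Plane) (n : ℕ) (hn : R.card + B.card = n)
    (hP : BichromaticFlip.SemiCollinear R B) (M : BichromaticFlip.BichromaticMatching R B) :
    ∃ k : ℕ, BichromaticFlip.minFlips M = (k : ℕ∞) ∧
      (k : ℝ) ≤ (n : ℝ) ^ 2 / 4 - (n : ℝ) / 2 := by
  obtain ⟨D⟩ := hP.nonempty_dualModel
  obtain ⟨k, hk, hseq⟩ := D.exists_hasFlipSequence M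
  obtain ⟨j, hj, hmin⟩ := BichromaticFlip.exists_minFlips_eq hseq
  refine ⟨j, hmin, ?_⟩
  have hcard : R.card = B.card := by simpa using Fintype.card_congr M
  have hn' : (n : ℝ) = 2 * B.card := by
    rw [← hn, hcard]
    push_cast
    ring
  have hle : (j : ℝ) ≤ (B.card : ℝ) * (B.card - 1) := by
    refine le_trans (Nat.cast_le.2 (hj.trans hk)) ?_
    -- The natural subtraction `B.card - 1` truncates when `B` is empty, where both sides are zero.
    rcases Nat.eq_zero_or_pos B.card with h0 | h0
    · simp [h0]
    · rw [Nat.cast_mul, Nat.cast_sub h0, Nat.cast_one]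
  rw [hn']
  linarith
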